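/- Let $\mathbb N=\{1,2,3,\dots\}$. For every countable limit ordinal $\beta$ fix a sequence $(\beta_n)_{n\in\mathbb N}$ of ordinals in $[0,\beta)$ increasing to $\beta$. Define families $\mathrm S_\alpha$ ($\alpha<\omega_1$) of finite subsets of $\mathbb N$ by $\mathrm S_0=\{\{n\}:n\in\mathbb N\}$; $\mathrm S_{\alpha+1}=\big\{\bigcup_{j=1}^nE_j: n\in\mathbb N,\ E_1,\dots,E_n\in\mathrm S_\alpha,\ n\le \min E_1,\ \max E_j<\min E_{j+1}\text{ for }1\le j<n\big\}$; and, for a limit ordinal $\beta$, $\mathrm S_\beta=\{A: \exists n\in\mathbb N,\ n\le\min A\text{ and }A\in\mathrm S_{\beta_n}\}$. Let $c_0$ be the space of real null sequences indexed by $\mathbb N$ with the norm $\|\cdot\|_\infty$ and unit vectors $e_i$, and let $(\mathrm S_\alpha(\mathbb Z),d_\infty)$ be the set $\{\sum_{i\in G}c_ie_i: G\in\mathrm S_\alpha,\ c_i\in\mathbb Z\}\subset c_0$ with the metric induced by $\|\cdot\|_\infty$. For functions $\rho,\omega:[0,\infty)\to[0,\infty)$, a map $f:X\to Y$ between metric spaces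 is a $(\rho,\omega)$-embedding if $\rho(d_X(x,y))\le d_Y(f(x),f(y))\le\omega(d_X(x,y))$ for all $x,y\in X$. A class of metric spaces embeds equi-coarsely into $Y$ if there are non-decreasing $\rho,\omega:[0,\infty)\to[0,\infty)$ with $\lim_{t\to\infty}\rho(t)=\infty$ such that every member of the class admits a $(\rho,\omega)$-embedding into $Y$; a single space embeds coarsely into $Y$ if the class consisting of it alone embeds equi-coarsely. Theorem (in ZFC, without extra set-theoretic axioms). Let $(M,d)$ be a separable metric space such that for every $\alpha<\omega_1$ the metric space $(\mathrm S_\alpha(\mathbb Z),d_\infty)$ embeds coarsely into $(M,d)$. Then the class of all separable bounded metric spaces embeds equi-coarsely into $(M,d)$. More precisely, there exist $m_0\in M$, non-decreasing functions $\rho,\omega:[0,\infty)\to[0,\infty)$ with $\lim_{t\to\infty}\rho(t)=\infty$, and, for every integer $n\ge 0$, a $(\rho,\omega)$-embedding $F_n:\{x\in c_0:\|x\|_\infty\le n\}\to M$ with $F_n(0)=m_0$. -/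

import Mathlib

open scoped NNReal Ordinal ZeroAtInfty

/-- A choice, for every countable limit ordinal `β`, of a sequence `φ β 1 ≤ φ β 2 ≤ …` of ordinals
below `β` which increases to `β`. -/
def IsLimitSequenceChoice (φ : Ordinal.{0} → ℕ+ → Ordinal.{0}) : Prop :=
  ∀ β : Ordinal.{0}, β < ω₁ → Order.IsSuccLimit β →
    Monotone (φ β) ∧ (∀ n, φ β n < β) ∧ ∀ γ < β, ∃ n, γ < φ β n

/-- The Schreier families, as sets of finite subsets of `{1, 2, 3, …}`, relative to the sequences
`φ β` approximating the limit ordinals `β`: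
* order `0`: the singletons;
* order `α + 1`: the sets `E₁ ∪ … ∪ Eₙ`, where `n ≥ 1`, all `Eⱼ` are in the family of order `α` and
  `n ≤ E₁ < E₂ < … < Eₙ`;
* limit order `β`: the sets `A` such that, for some `n ≥ 1`, `n ≤ A` and `A` is in the family of
  order `φ β n`. -/
noncomputable def schreier (φ : Ordinal.{0} → ℕ+ → Ordinal.{0}) (α : Ordinal.{0}) :
    Set (Finset ℕ+) :=
  Ordinal.limitRecOn (motive := fun _ => Set (Finset ℕ+)) α
    {A | ∃ n : ℕ+, A = {n}}
    (fun _ S => {A | ∃ (n : ℕ+) (E : Fin (n : ℕ) → Finset ℕ+),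
      (∀ j, E j ∈ S) ∧
      (∀ j, ∀ a ∈ E j, n ≤ a) ∧
      (∀ i j, i < j → ∀ a ∈ E i, ∀ b ∈ E j, a < b) ∧
      A = Finset.univ.biUnion E})
    (fun β _ S => {A | ∃ n : ℕ+, (∀ a ∈ A, n ≤ a) ∧ ∃ h : φ β n < β, A ∈ S (φ β n) h})

/-- The set of all `∑ i ∈ G, c i • e i` with `G ∈ 𝒢` and `c i ∈ E` for `i ∈ G`, where `e i` are the
unit vectors of `c₀ = C₀(ℕ+, ℝ)` (`ℕ+` is discrete). As a subtype of `C₀(ℕ+, ℝ)` it carries the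
metric induced by the supremum norm. -/
def finSuppSpace (𝒢 : Set (Finset ℕ+)) (E : Set ℝ) : Set C₀(ℕ+, ℝ) :=
  {x | ∃ G ∈ 𝒢, (∀ i ∈ G, x i ∈ E) ∧ ∀ i ∉ G, x i = 0}

/-- The integer-valued Schreier metric space of order `α`. -/
def schreierSpace (φ : Ordinal.{0} → ℕ+ → Ordinal.{0}) (α : Ordinal.{0}) : Set C₀(ℕ+, ℝ) :=
  finSuppSpace (schreier φ α) (Set.range ((↑) : ℤ → ℝ))

/-- `ρ, σ : [0,∞) → [0,∞)` are non-decreasing and `ρ t → ∞` as `t → ∞`. -/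
def AreCoarseModuli (ρ σ : ℝ≥0 → ℝ≥0) : Prop :=
  Monotone ρ ∧ Monotone σ ∧ Filter.Tendsto ρ Filter.atTop Filter.atTop

/-- `ρ (d x y) ≤ d (f x) (f y) ≤ σ (d x y)` for all `x` and `y`. -/
def IsModuliEmbedding {X Y : Type*} [MetricSpace X] [MetricSpace Y] (ρ σ : ℝ≥0 → ℝ≥0)
    (f : X → Y) : Prop :=
  ∀ x y, ρ (nndist x y) ≤ nndist (f x) (f y) ∧ nndist (f x) (f y) ≤ σ (nndist x y)

/-- `X` embeds coarsely into `Y`. -/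
def CoarselyEmbeds (X Y : Type*) [MetricSpace X] [MetricSpace Y] : Prop :=
  ∃ ρ σ : ℝ≥0 → ℝ≥0, AreCoarseModuli ρ σ ∧ ∃ f : X → Y, IsModuliEmbedding ρ σ f

/-! Perturbing a coarse embedding of an integer Schreier space into a dense sequence `q` of `M`
makes its values, and its moduli, natural numbers. A countable union of bounded subsets of `ω₁` is
bounded, so any datum taking countably many values is constant for orders cofinal in `ω₁`. This
first fixes the image of `0` and, value by value, common moduli (`exists_coherent_choice`).

Now fix `n`. The tree of initial segments of the Schreier family of order `α` has rank at least `α`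
(`hasDepth_schreier`). Along a branch `s 0 < s 1 < …`, the embedding restricted to vectors with
entries in `[-n, n]` on the first `k` places is one of countably many functions. The same argument
picks these functions coherently in `k`, each new place costing one unit of rank. Any two finitely
supported vectors lie in a common finite cube, so the union of the functions embeds the integer ball
(`exists_embedding_intBall`).

Rounding passes to balls of `c₀`, and bump functions at integer scales embed every bounded separable
space into such a ball (`exists_embedding_c₀_ball`). -/

/-! ### Pigeonhole arguments along `ω₁` -/

/-- A property of countable ordinals and elements of a countable type that is inherited by smaller
ordinals and satisfiable for every countable ordinal is satisfied by one fixed element. -/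
theorem exists_forall_lt_omega_one {C : Type} [Countable C] {P : Ordinal.{0} → C → Prop}
    (hP : ∀ γ δ c, γ ≤ δ → P δ c → P γ c) (h : ∀ γ < ω₁, ∃ c, P γ c) :
    ∃ c, ∀ γ < ω₁, P γ c := by
  by_contra! hc
  choose γ hγ hγP using hc
  have hlt : (⨆ c, γ c) < ω₁ := Ordinal.iSup_lt_omega_one hγ
  obtain ⟨c, hc⟩ := h _ hlt
  exact hγP c (hP _ _ _ (Ordinal.le_iSup γ c) hc)

/-- A branch of `C 0 × C 1 × …` along which all finite parts are realised by objects of arbitrarily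
large countable rank. -/
theorem exists_coherent_choice {Ob : Type*} (Good : Ordinal.{0} → ℕ → Ob → Prop) {C : ℕ → Type}
    [∀ k, Countable (C k)] (val : ∀ k, Ob → C k)
    (hmono : ∀ γ δ k o, γ ≤ δ → Good δ k o → Good γ k o)
    (hzero : ∀ γ < ω₁, ∃ o, Good γ 0 o)
    (hsucc : ∀ γ < ω₁, ∀ k o, Good (γ + 1) k o →
      ∃ o', Good γ (k + 1) o' ∧ ∀ j ≤ k, val j o' = val j o) :
    ∃ u : ∀ k, C k, ∀ k, ∀ γ < ω₁, ∃ o, Good γ k o ∧ ∀ j ≤ k, val j o = u j := by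
  classical
  let P : ℕ → (∀ k, C k) → Prop := fun k u => ∀ γ < ω₁, ∃ o, Good γ k o ∧ ∀ j ≤ k, val j o = u j
  have hω : Order.IsSuccLimit (ω₁ : Ordinal.{0}) := Cardinal.isSuccLimit_omega 1
  have base : ∃ u, P 0 u := by
    obtain ⟨o₀, -⟩ := hzero 0 hω.bot_lt
    obtain ⟨c, hc⟩ := exists_forall_lt_omega_one (C := C 0)
      (P := fun γ c => ∃ o, Good γ 0 o ∧ val 0 o = c)
      (fun γ δ c hγ ⟨o, ho, hoc⟩ => ⟨o, hmono _ _ _ _ hγ ho, hoc⟩)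
      (fun γ hγ => (hzero γ hγ).imp' (val 0) fun o ho => ⟨o, ho, rfl⟩)
    refine ⟨Function.update (fun k => val k o₀) 0 c, fun γ hγ => ?_⟩
    obtain ⟨o, ho, hoc⟩ := hc γ hγ
    refine ⟨o, ho, fun j hj => ?_⟩
    obtain rfl : j = 0 := by omega
    simpa using hoc
  have step : ∀ k u, P k u → ∃ u', P (k + 1) u' ∧ ∀ j ≤ k, u' j = u j := by
    intro k u hu
    obtain ⟨c, hc⟩ := exists_forall_lt_omega_one (C := C (k + 1))
      (P := fun γ c => ∃ o, Good γ (k + 1) o ∧ (∀ j ≤ k, val j o = u j) ∧ val (k + 1) o = c)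
      (fun γ δ c hγ ⟨o, ho, hoc⟩ => ⟨o, hmono _ _ _ _ hγ ho, hoc⟩) (fun γ hγ => by
        -- Since `ω₁` is a limit, one unit of rank can be spent at each level.
        obtain ⟨o, ho, hou⟩ := hu (γ + 1) (hω.add_one_lt hγ)
        obtain ⟨o', ho', h'⟩ := hsucc γ hγ k o ho
        exact ⟨_, o', ho', fun j hj => (h' j hj).trans (hou j hj), rfl⟩)
    refine ⟨Function.update u (k + 1) c, fun γ hγ => ?_, fun j hj => ?_⟩
    · obtain ⟨o, ho, hou, hoc⟩ := hc γ hγ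
      refine ⟨o, ho, fun j hj => ?_⟩
      rcases Nat.le_succ_iff.1 hj with hj | rfl
      · rw [Function.update_of_ne (by omega), hou j hj]
      · simpa using hoc
    · rw [Function.update_of_ne (by omega)]
  choose! next hnext hagree using step
  obtain ⟨u₀, hu₀⟩ := base
  let U : ℕ → ∀ k, C k := fun k => Nat.rec u₀ next k
  have hU : ∀ k, P k (U k) := fun k => by
    induction k with
    | zero => exact hu₀
    | succ k ih => exact hnext k _ ih
  have hUU : ∀ j k, j ≤ k → U k j = U j j := fun j k hjk => by
    induction k, hjk using Nat.le_induction with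
    | base => rfl
    | succ k hjk ih => exact (hagree k _ (hU k) j hjk).trans ih
  refine ⟨fun k => U k k, fun k γ hγ => ?_⟩
  obtain ⟨o, ho, h⟩ := hU k γ hγ
  exact ⟨o, ho, fun j hj => (h j hj).trans (hUU j k hj)⟩

/-! ### Rank of the Schreier families -/

/-- The members of `𝒢` with least element `i`, with that element removed. -/
def tailFamily (i : ℕ+) (𝒢 : Set (Finset ℕ+)) : Set (Finset ℕ+) :=
  {E | (∀ a ∈ E, i < a) ∧ insert i E ∈ 𝒢}

theorem tailFamily_mono {i : ℕ+} {𝒢 ℋ : Set (Finset ℕ+)} (h : 𝒢 ⊆ ℋ) :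
    tailFamily i 𝒢 ⊆ tailFamily i ℋ :=
  fun _ hE => ⟨hE.1, h hE.2⟩

/-- The tree of initial segments of members of `𝒢` has rank at least `γ`. -/
def HasDepth (γ : Ordinal.{0}) (𝒢 : Set (Finset ℕ+)) : Prop :=
  𝒢.Nonempty ∧ ∀ δ, δ < γ → ∃ i, HasDepth δ (tailFamily i 𝒢)
termination_by γ

theorem HasDepth.nonempty {γ : Ordinal.{0}} {𝒢 : Set (Finset ℕ+)} (h : HasDepth γ 𝒢) :
    𝒢.Nonempty := by
  rw [HasDepth] at h
  exact h.1

theorem HasDepth.exists_tailFamily {γ δ : Ordinal.{0}} {𝒢 : Set (Finset ℕ+)} (h : HasDepth γ 𝒢)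
    (hδ : δ < γ) : ∃ i, HasDepth δ (tailFamily i 𝒢) := by
  rw [HasDepth] at h
  exact h.2 δ hδ

theorem HasDepth.anti {γ δ : Ordinal.{0}} {𝒢 : Set (Finset ℕ+)} (h : HasDepth γ 𝒢)
    (hδ : δ ≤ γ) : HasDepth δ 𝒢 := by
  rw [HasDepth]
  exact ⟨h.nonempty, fun ε hε => h.exists_tailFamily (hε.trans_le hδ)⟩

theorem HasDepth.mono {γ : Ordinal.{0}} {𝒢 ℋ : Set (Finset ℕ+)} (h : HasDepth γ 𝒢)
    (hsub : 𝒢 ⊆ ℋ) : HasDepth γ ℋ := by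
  induction γ using WellFoundedLT.induction generalizing 𝒢 ℋ with
  | ind γ ih =>
    rw [HasDepth]
    refine ⟨h.nonempty.mono hsub, fun δ hδ => ?_⟩
    obtain ⟨i, hi⟩ := h.exists_tailFamily hδ
    exact ⟨i, ih δ hδ hi (tailFamily_mono hsub)⟩

section Schreier

variable {φ : Ordinal.{0} → ℕ+ → Ordinal.{0}}

theorem mem_schreier_zero {A : Finset ℕ+} : A ∈ schreier φ 0 ↔ ∃ n : ℕ+, A = {n} := by
  unfold schreier
  rw [Ordinal.limitRecOn_zero]
  rfl

theorem mem_schreier_add_one {α : Ordinal.{0}} {A : Finset ℕ+} :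
    A ∈ schreier φ (α + 1) ↔ ∃ (n : ℕ+) (E : Fin (n : ℕ) → Finset ℕ+),
      (∀ j, E j ∈ schreier φ α) ∧
      (∀ j, ∀ a ∈ E j, n ≤ a) ∧
      (∀ i j, i < j → ∀ a ∈ E i, ∀ b ∈ E j, a < b) ∧
      A = Finset.univ.biUnion E := by
  unfold schreier
  rw [Ordinal.limitRecOn_add_one]
  rfl

theorem mem_schreier_limit {β : Ordinal.{0}} (hβ : Order.IsSuccLimit β) {A : Finset ℕ+} :
    A ∈ schreier φ β ↔
      ∃ n : ℕ+, (∀ a ∈ A, n ≤ a) ∧ φ β n < β ∧ A ∈ schreier φ (φ β n) := by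
  unfold schreier
  rw [Ordinal.limitRecOn_limit _ _ _ _ hβ]
  simp only [Set.mem_ofPred_eq, exists_prop]

theorem singleton_mem_schreier (hφ : IsLimitSequenceChoice φ) {α : Ordinal.{0}} (hα : α < ω₁)
    (i : ℕ+) : {i} ∈ schreier φ α := by
  induction α using Ordinal.limitRecOn with
  | zero => exact mem_schreier_zero.2 ⟨i, rfl⟩
  | add_one α ih =>
    refine mem_schreier_add_one.2 ⟨1, fun _ => {i}, fun _ => ih ?_, fun _ _ _ => one_le,
      fun a b hab => ?_, ?_⟩
    · exact (lt_add_one α).trans hα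
    · have ha : (a : ℕ) < 1 := a.2
      have hb : (b : ℕ) < 1 := b.2
      have : (a : ℕ) < b := hab
      omega
    · ext a
      simp only [Finset.mem_singleton, Finset.mem_biUnion, Finset.mem_univ, true_and]
      exact ⟨fun h => ⟨⟨0, one_pos⟩, h⟩, fun ⟨_, h⟩ => h⟩
  | limit β hβ ih =>
    have hlt := (hφ β hα hβ).2.1 1
    exact (mem_schreier_limit hβ).2 ⟨1, fun _ _ => one_le, hlt, ih _ hlt (hlt.trans hα)⟩

theorem insert_mem_schreier_add_one (hφ : IsLimitSequenceChoice φ) {α : Ordinal.{0}} (hα : α < ω₁)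
    {i : ℕ+} (hi : 2 ≤ i) {E : Finset ℕ+} (hE : E ∈ schreier φ α) (hiE : ∀ a ∈ E, i < a) :
    insert i E ∈ schreier φ (α + 1) := by
  refine mem_schreier_add_one.2 ⟨2, fun j => if (j : ℕ) = 0 then {i} else E, fun j => ?_,
    fun j a ha => ?_, fun j k hjk a ha b hb => ?_, ?_⟩
  · dsimp only
    split_ifs
    exacts [singleton_mem_schreier hφ hα i, hE]
  · dsimp only at ha
    split_ifs at ha
    · rwa [Finset.mem_singleton.1 ha]
    · exact hi.trans (hiE a ha).le
  · have hk : (k : ℕ) < 2 := k.2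
    have hlt : (j : ℕ) < k := hjk
    dsimp only at ha hb
    rw [if_pos (by omega), Finset.mem_singleton] at ha
    rw [if_neg (by omega)] at hb
    exact ha ▸ hiE b hb
  · ext a
    simp only [Finset.mem_insert, Finset.mem_biUnion, Finset.mem_univ, true_and]
    constructor
    · rintro (rfl | ha)
      · exact ⟨⟨0, two_pos⟩, by simp⟩
      · exact ⟨⟨1, one_lt_two⟩, by simpa using ha⟩
    · rintro ⟨j, hj⟩
      split_ifs at hj
      · exact Or.inl (Finset.mem_singleton.1 hj)
      · exact Or.inr hj

/-- The lower bound `N` makes the induction work: it leaves room for a new least element at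
successors, and supplies the condition `n ≤ min A` at limits. -/
theorem hasDepth_schreier (hφ : IsLimitSequenceChoice φ) {α : Ordinal.{0}} (hα : α < ω₁) (N : ℕ+) :
    HasDepth α {E | E ∈ schreier φ α ∧ ∀ a ∈ E, N ≤ a} := by
  induction α using Ordinal.limitRecOn generalizing N with
  | zero =>
    rw [HasDepth]
    exact ⟨⟨{N}, singleton_mem_schreier hφ hα N, by simp⟩, fun δ hδ => absurd hδ not_lt_zero⟩
  | add_one α ih =>
    have hα' := (lt_add_one α).trans hα
    rw [HasDepth]
    -- A union of the two blocks `{i}` and `E` is admissible only if `2 ≤ i`.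
    refine ⟨⟨{N}, singleton_mem_schreier hφ hα N, by simp⟩, fun δ hδ => ⟨max N 2, ?_⟩⟩
    refine ((ih hα' (max N 2 + 1)).anti (Order.lt_add_one_iff.1 hδ)).mono ?_
    rintro E ⟨hE, hN⟩
    have hlt : ∀ a ∈ E, max N 2 < a := fun a ha => PNat.add_one_le_iff.1 (hN a ha)
    refine ⟨hlt, insert_mem_schreier_add_one hφ hα' (le_max_right _ _) hE hlt, fun a ha => ?_⟩
    rcases Finset.mem_insert.1 ha with rfl | ha
    · exact le_max_left _ _
    · exact (le_max_left _ _).trans (hlt a ha).le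
  | limit β hβ ih =>
    obtain ⟨-, hlt, hcof⟩ := hφ β hα hβ
    rw [HasDepth]
    refine ⟨⟨{N}, singleton_mem_schreier hφ hα N, by simp⟩, fun δ hδ => ?_⟩
    obtain ⟨n, hn⟩ := hcof δ hδ
    obtain ⟨i, hi⟩ := (ih _ (hlt n) ((hlt n).trans hα) (max N n)).exists_tailFamily hn
    refine ⟨i, hi.mono (tailFamily_mono ?_)⟩
    rintro E ⟨hE, hN⟩
    exact ⟨(mem_schreier_limit hβ).2 ⟨n, fun a ha => (le_max_right _ _).trans (hN a ha), hlt n, hE⟩,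
      fun a ha => (le_max_left _ _).trans (hN a ha)⟩

end Schreier

/-! ### Integer vectors in `c₀` -/

/-- The supremum norm of a finitely supported integer vector. -/
def supNatAbs {ι : Type*} (v : ι →₀ ℤ) : ℕ :=
  v.support.sup fun i => (v i).natAbs

theorem natAbs_le_supNatAbs {ι : Type*} (v : ι →₀ ℤ) (i : ι) : (v i).natAbs ≤ supNatAbs v := by
  by_cases hi : i ∈ v.support
  · exact Finset.le_sup (f := fun i => (v i).natAbs) hi
  · simp [Finsupp.notMem_support_iff.1 hi]

theorem supNatAbs_le_iff {ι : Type*} {v : ι →₀ ℤ} {n : ℕ} :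
    supNatAbs v ≤ n ↔ ∀ i, (v i).natAbs ≤ n :=
  ⟨fun h i => (natAbs_le_supNatAbs v i).trans h, fun h => Finset.sup_le fun i _ => h i⟩

theorem supNatAbs_mapDomain {ι κ : Type*} {s : ι → κ} (hs : Function.Injective s) (v : ι →₀ ℤ) :
    supNatAbs (v.mapDomain s) = supNatAbs v := by
  classical
  unfold supNatAbs
  rw [Finsupp.mapDomain_support_of_injective hs, Finset.sup_image]
  exact Finset.sup_congr rfl fun i _ => by simp [Finsupp.mapDomain_apply hs]

theorem supNatAbs_mapDomain_sub {ι κ : Type*} {s : ι → κ} (hs : Function.Injective s)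
    (v w : ι →₀ ℤ) : supNatAbs (v.mapDomain s - w.mapDomain s) = supNatAbs (v - w) := by
  rw [← supNatAbs_mapDomain hs]
  congr 1
  exact ((Finsupp.mapDomain.addMonoidHom s).map_sub v w).symm

/-- A finitely supported integer vector as an element of `c₀`. -/
def intVector (v : ℕ+ →₀ ℤ) : C₀(ℕ+, ℝ) where
  toFun i := v i
  continuous_toFun := continuous_of_discreteTopology
  zero_at_infty' := by
    rw [Filter.cocompact_eq_cofinite]
    refine tendsto_const_nhds.congr' ?_
    rw [Filter.EventuallyEq, Filter.eventually_cofinite]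
    refine v.support.finite_toSet.subset fun i hi => ?_
    simp only [Finset.mem_coe, Finsupp.mem_support_iff]
    exact fun h => hi (by simp [h])

theorem intVector_apply (v : ℕ+ →₀ ℤ) (i : ℕ+) : intVector v i = v i := rfl

theorem c₀_dist_le_iff {x y : C₀(ℕ+, ℝ)} {C : ℝ} (hC : 0 ≤ C) :
    dist x y ≤ C ↔ ∀ i, |x i - y i| ≤ C := by
  rw [← ZeroAtInftyContinuousMap.dist_toBCF_eq_dist, BoundedContinuousFunction.dist_le hC]
  rfl

theorem c₀_abs_sub_le_dist (x y : C₀(ℕ+, ℝ)) (i : ℕ+) : |x i - y i| ≤ dist x y :=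
  (c₀_dist_le_iff dist_nonneg).1 le_rfl i

theorem abs_sub_intCast (a b : ℤ) : |(a : ℝ) - b| = ((a - b).natAbs : ℕ) := by
  rw [Nat.cast_natAbs, Int.cast_abs, Int.cast_sub]

theorem dist_intVector (v w : ℕ+ →₀ ℤ) : dist (intVector v) (intVector w) = supNatAbs (v - w) := by
  apply le_antisymm
  · rw [c₀_dist_le_iff (Nat.cast_nonneg _)]
    intro i
    rw [intVector_apply, intVector_apply, abs_sub_intCast]
    exact_mod_cast natAbs_le_supNatAbs (v - w) i
  · have : supNatAbs (v - w) ≤ ⌊dist (intVector v) (intVector w)⌋₊ := by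
      rw [supNatAbs_le_iff]
      intro i
      rw [Nat.le_floor_iff dist_nonneg]
      have := c₀_abs_sub_le_dist (intVector v) (intVector w) i
      rwa [intVector_apply, intVector_apply, abs_sub_intCast] at this
    exact (Nat.le_floor_iff dist_nonneg).1 this

/-! ### From Schreier spaces to integer balls -/

section Schreier

variable {φ : Ordinal.{0} → ℕ+ → Ordinal.{0}} {M : Type*} [MetricSpace M]

/-- On the integer vectors supported in members of `𝒢`, the map `q ∘ f` expands distances to at
most `w`, and to at least `k` as soon as they are at least `t k`. -/
def IsDiscreteEmbedding (q : ℕ → M) (𝒢 : Set (Finset ℕ+)) (f : (ℕ+ →₀ ℤ) → ℕ) (w t : ℕ → ℕ) :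
    Prop :=
  ∀ x y : ℕ+ →₀ ℤ, (∃ G ∈ 𝒢, x.support ⊆ G) → (∃ G ∈ 𝒢, y.support ⊆ G) →
    dist (q (f x)) (q (f y)) ≤ w (supNatAbs (x - y)) ∧
    ∀ k, t k ≤ supNatAbs (x - y) → (k : ℝ) ≤ dist (q (f x)) (q (f y))

theorem exists_isDiscreteEmbedding {q : ℕ → M} (hq : DenseRange q) {α : Ordinal.{0}}
    (h : CoarselyEmbeds (schreierSpace φ α) M) :
    ∃ (f : (ℕ+ →₀ ℤ) → ℕ) (w t : ℕ → ℕ), Monotone w ∧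
      IsDiscreteEmbedding q (schreier φ α) f w t := by
  classical
  obtain ⟨ρ, σ, ⟨hρ, hσ, hlim⟩, f, hf⟩ := h
  have hmem : ∀ x : ℕ+ →₀ ℤ, (∃ G ∈ schreier φ α, x.support ⊆ G) →
      intVector x ∈ schreierSpace φ α := by
    rintro x ⟨G, hG, hx⟩
    exact ⟨G, hG, fun i _ => ⟨x i, rfl⟩, fun i hi => by
      rw [intVector_apply, Finsupp.notMem_support_iff.1 fun h => hi (hx h), Int.cast_zero]⟩
  have happrox : ∀ x : ℕ+ →₀ ℤ, ∃ m, ∀ hx : intVector x ∈ schreierSpace φ α,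
      dist (f ⟨_, hx⟩) (q m) < 1 / 2 := by
    intro x
    by_cases hx : intVector x ∈ schreierSpace φ α
    · obtain ⟨m, hm⟩ := hq.exists_dist_lt (f ⟨_, hx⟩) (half_pos one_pos)
      exact ⟨m, fun _ => hm⟩
    · exact ⟨0, fun h => absurd h hx⟩
  choose g hg using happrox
  -- The extra `1` pays for moving both images by less than `1 / 2`.
  have ht : ∀ k : ℕ, ∃ t : ℕ, (k + 1 : ℝ≥0) ≤ ρ t := fun k =>
    ((hlim.comp tendsto_natCast_atTop_atTop).eventually_ge_atTop (k + 1 : ℝ≥0)).exists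
  choose t ht using ht
  refine ⟨g, fun k => ⌈σ k⌉₊ + 1, t, fun a b hab => ?_, fun x y hx hy => ?_⟩
  · exact Nat.add_le_add_right (Nat.ceil_mono (hσ (by exact_mod_cast hab))) 1
  · have hx' := hmem x hx
    have hy' := hmem y hy
    obtain ⟨h₁, h₂⟩ := hf ⟨_, hx'⟩ ⟨_, hy'⟩
    have hd : nndist (⟨_, hx'⟩ : schreierSpace φ α) ⟨_, hy'⟩ = (supNatAbs (x - y) : ℝ≥0) := by
      rw [← NNReal.coe_inj, coe_nndist, Subtype.dist_eq, NNReal.coe_natCast]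
      exact dist_intVector x y
    rw [hd] at h₁ h₂
    rw [← NNReal.coe_le_coe, coe_nndist] at h₁ h₂
    have hgx := hg x hx'
    have hgy := hg y hy'
    have t₁ := dist_triangle4 (q (g x)) (f ⟨_, hx'⟩) (f ⟨_, hy'⟩) (q (g y))
    have t₂ := dist_triangle4 (f ⟨_, hx'⟩) (q (g x)) (q (g y)) (f ⟨_, hy'⟩)
    rw [dist_comm (q (g x)) (f _)] at t₁
    rw [dist_comm (q (g y)) (f _)] at t₂
    constructor
    · have : ((σ (supNatAbs (x - y)) : ℝ≥0) : ℝ) ≤ (⌈σ (supNatAbs (x - y))⌉₊ : ℝ) := by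
        exact_mod_cast Nat.le_ceil (σ (supNatAbs (x - y)))
      push_cast
      linarith
    · intro k hk
      have h₃ : ((k : ℝ≥0) + 1) ≤ ρ (supNatAbs (x - y)) := (ht k).trans (hρ (by exact_mod_cast hk))
      rw [← NNReal.coe_le_coe] at h₃
      push_cast at h₃
      linarith

/-- The members of `𝒢` that start with `s 0, …, s (k - 1)`, with these elements removed. -/
def extensionFamily (s : ℕ → ℕ+) (k : ℕ) (𝒢 : Set (Finset ℕ+)) : Set (Finset ℕ+) :=
  {E | (∀ j < k, ∀ a ∈ E, s j < a) ∧ (Finset.range k).image s ∪ E ∈ 𝒢}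

theorem HasDepth.exists_extensionFamily {γ : Ordinal.{0}} {s : ℕ → ℕ+} (hs : StrictMono s) {k : ℕ}
    {𝒢 : Set (Finset ℕ+)} (h : HasDepth (γ + 1) (extensionFamily s k 𝒢)) :
    ∃ s' : ℕ → ℕ+, StrictMono s' ∧ (∀ j < k, s' j = s j) ∧
      HasDepth γ (extensionFamily s' (k + 1) 𝒢) := by
  obtain ⟨i, hi⟩ := h.exists_tailFamily (lt_add_one γ)
  obtain ⟨E₀, -, hE₀, -⟩ := hi.nonempty
  have hlt : ∀ j < k, s j < i := fun j hj => hE₀ j hj i (Finset.mem_insert_self _ _)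
  -- Only the value `i` at `k` matters; the later values merely keep the sequence strictly
  -- increasing.
  let s' : ℕ → ℕ+ := fun j => if j < k then s j else Nat.rec i (fun _ a => a + 1) (j - k)
  have hs'k : ∀ j < k, s' j = s j := fun j hj => if_pos hj
  have hs'i : s' k = i := by simp [s']
  refine ⟨s', strictMono_nat_of_lt_succ fun j => ?_, hs'k, hi.mono ?_⟩
  · rcases lt_trichotomy (j + 1) k with hj | rfl | hj
    · rw [hs'k j (by omega), hs'k _ hj]
      exact hs j.lt_succ_self
    · rw [hs'k j j.lt_succ_self, hs'i]
      exact hlt j j.lt_succ_self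
    · have h₁ : j + 1 - k = (j - k) + 1 := by omega
      simp only [s', if_neg (show ¬ j < k by omega), if_neg (show ¬ j + 1 < k by omega), h₁]
      exact PNat.lt_add_right _ _
  · rintro E ⟨hiE, hE, hmem⟩
    refine ⟨fun j hj a ha => ?_, ?_⟩
    · rcases Nat.lt_succ_iff_lt_or_eq.1 hj with hj | rfl
      · rw [hs'k j hj]
        exact hE j hj a (Finset.mem_insert_of_mem ha)
      · rw [hs'i]
        exact hiE a ha
    · rw [Finset.range_add_one, Finset.image_insert, hs'i,
        Finset.image_congr (g := s) fun j hj => hs'k j (Finset.mem_range.1 hj)]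
      rwa [Finset.insert_union, ← Finset.union_insert]

/-- The integer vectors with entries in `[-n, n]` and support in `{0, …, k - 1}`. -/
noncomputable def intCube (n k : ℕ) : Finset (ℕ →₀ ℤ) :=
  (Finset.range k).finsupp fun _ => Finset.Icc (-n : ℤ) n

theorem mem_intCube {n k : ℕ} {v : ℕ →₀ ℤ} :
    v ∈ intCube n k ↔ v.support ⊆ Finset.range k ∧ supNatAbs v ≤ n := by
  rw [intCube, Finset.mem_finsupp_iff, supNatAbs_le_iff]
  refine and_congr_right fun hv => ⟨fun h i => ?_, fun h i _ => ?_⟩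
  · by_cases hi : i ∈ Finset.range k
    · have := Finset.mem_Icc.1 (h i hi)
      omega
    · rw [Finsupp.notMem_support_iff.1 fun h => hi (hv h)]
      simp
  · have := h i
    rw [Finset.mem_Icc]
    omega

theorem supNatAbs_sub_le {ι : Type*} {v w : ι →₀ ℤ} {n : ℕ} (hv : supNatAbs v ≤ n)
    (hw : supNatAbs w ≤ n) : supNatAbs (v - w) ≤ 2 * n := by
  rw [supNatAbs_le_iff] at *
  intro i
  have h₁ := hv i
  have h₂ := hw i
  rw [Finsupp.sub_apply]
  omega

/-- Agreeing discrete embeddings of the Schreier spaces of arbitrarily large order yield an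
embedding of the ball of integer vectors. -/
theorem exists_embedding_intBall (hφ : IsLimitSequenceChoice φ) {q : ℕ → M}
    {f : Ordinal.{0} → (ℕ+ →₀ ℤ) → ℕ} {w t : Ordinal.{0} → ℕ → ℕ}
    (hf : ∀ α < ω₁, IsDiscreteEmbedding q (schreier φ α) (f α) (w α) (t α))
    {W T : ℕ → ℕ} {m n : ℕ}
    (h : ∀ γ < ω₁, ∃ α, γ ≤ α ∧ α < ω₁ ∧ (∀ j ≤ 2 * n, w α j = W j ∧ t α j = T j) ∧ f α 0 = m) :
    ∃ F : (ℕ →₀ ℤ) → ℕ, F 0 = m ∧ ∀ x y, supNatAbs x ≤ n → supNatAbs y ≤ n →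
      dist (q (F x)) (q (F y)) ≤ W (supNatAbs (x - y)) ∧
      ∀ k ≤ supNatAbs (x - y), T k ≤ supNatAbs (x - y) → (k : ℝ) ≤ dist (q (F x)) (q (F y)) := by
  let Good : Ordinal.{0} → ℕ → Ordinal.{0} × (ℕ → ℕ+) → Prop := fun γ k o =>
    o.1 < ω₁ ∧ ((∀ j ≤ 2 * n, w o.1 j = W j ∧ t o.1 j = T j) ∧ f o.1 0 = m) ∧ StrictMono o.2 ∧
      HasDepth γ (extensionFamily o.2 k (schreier φ o.1))
  -- The cubes are finite, so each type of restrictions is countable.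
  obtain ⟨u, hu⟩ := exists_coherent_choice (C := fun k => intCube n k → ℕ) Good
    (fun k o v => f o.1 ((v : ℕ →₀ ℤ).mapDomain o.2))
    (fun γ δ k o hγ ho => ⟨ho.1, ho.2.1, ho.2.2.1, ho.2.2.2.anti hγ⟩)
    (fun γ hγ => by
      obtain ⟨α, hγα, hα, hP⟩ := h γ hγ
      refine ⟨(α, Nat.succPNat), hα, hP, fun a b hab => Nat.succPNat_lt_succPNat.2 hab,
        ((hasDepth_schreier hφ hα 1).anti hγα).mono fun E hE => ⟨fun j hj => ?_, ?_⟩⟩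
      · exact absurd hj (Nat.not_lt_zero j)
      · simpa using hE.1)
    (fun γ _ k o ho => by
      obtain ⟨hα, hP, hs, hd⟩ := ho
      obtain ⟨s', hs', hagree, hd'⟩ := hd.exists_extensionFamily hs
      refine ⟨(o.1, s'), ⟨hα, hP, hs', hd'⟩, fun j hj => funext fun v => ?_⟩
      congr 1
      -- Vectors in the cubes up to level `k` only see the places below `k`, where the sequence is
      -- unchanged.
      exact Finsupp.mapDomain_congr fun i hi => hagree i
        ((Finset.mem_range.1 ((mem_intCube.1 v.2).1 hi)).trans_le hj))
  have hω : (0 : Ordinal.{0}) < ω₁ := Ordinal.omega_pos 1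
  have hmem : ∀ v : ℕ →₀ ℤ, supNatAbs v ≤ n → ∃ k, v ∈ intCube n k := fun v hv =>
    ⟨v.support.sup id + 1, mem_intCube.2 ⟨fun i hi =>
      Finset.mem_range.2 (Nat.lt_succ_of_le (Finset.le_sup (f := id) hi)), hv⟩⟩
  classical
  let F : (ℕ →₀ ℤ) → ℕ := fun v => if hv : ∃ k, v ∈ intCube n k
    then u (Nat.find hv) ⟨v, Nat.find_spec hv⟩ else 0
  -- `F v` can be computed from any pair that realises `u` up to a large enough level.
  have hF : ∀ v (hv : supNatAbs v ≤ n), ∃ k₀, ∀ k ≥ k₀, v.support ⊆ Finset.range k ∧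
      ∀ o : Ordinal.{0} × (ℕ → ℕ+), (∀ j ≤ k, (fun v : intCube n j => f o.1 ((v : ℕ →₀ ℤ).mapDomain o.2)) = u j) →
        F v = f o.1 (v.mapDomain o.2) := by
    intro v hv
    have hv' := hmem v hv
    refine ⟨Nat.find hv', fun k hk => ⟨?_, fun o ho => ?_⟩⟩
    · exact (mem_intCube.1 (Nat.find_spec hv')).1.trans (Finset.range_subset_range.2 hk)
    · simp only [F, dif_pos hv']
      rw [← ho _ hk]
  refine ⟨F, ?_, fun x y hx hy => ?_⟩
  · obtain ⟨k, hk⟩ := hF 0 (by simp [supNatAbs])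
    obtain ⟨o, ho, hou⟩ := hu k 0 hω
    rw [(hk k le_rfl).2 o hou, Finsupp.mapDomain_zero, ho.2.1.2]
  · obtain ⟨k, hk⟩ := hF x hx
    obtain ⟨l, hl⟩ := hF y hy
    obtain ⟨o, ⟨hα, ⟨hP, -⟩, hs, hd⟩, hou⟩ := hu (max k l) 0 hω
    obtain ⟨hxs, hxF⟩ := hk _ (le_max_left k l)
    obtain ⟨hys, hyF⟩ := hl _ (le_max_right k l)
    rw [hxF o hou, hyF o hou]
    -- Rank `0` suffices here: the chosen places form part of a single Schreier set, so both vectors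
    -- lie in the Schreier space.
    obtain ⟨E, -, hE⟩ := hd.nonempty
    have hsupp : ∀ v : ℕ →₀ ℤ, v.support ⊆ Finset.range (max k l) →
        ∃ G ∈ schreier φ o.1, (v.mapDomain o.2).support ⊆ G := fun v hv =>
      ⟨_, hE, Finsupp.mapDomain_support.trans
        ((Finset.image_subset_image hv).trans Finset.subset_union_left)⟩
    have hxy := supNatAbs_sub_le hx hy
    have := hf o.1 hα _ _ (hsupp x hxs) (hsupp y hys)
    rw [supNatAbs_mapDomain_sub hs.injective, (hP _ hxy).1] at this
    -- The thresholds agree with `T` only up to `2 * n`; the bound on `i` by the distance keeps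
    -- within this range.
    exact ⟨this.1, fun i hi hTi => this.2 i ((hP i (hi.trans hxy)).2 ▸ hTi)⟩

end Schreier

theorem exists_discrete_ball_embeddings {φ : Ordinal.{0} → ℕ+ → Ordinal.{0}}
    (hφ : IsLimitSequenceChoice φ) {M : Type*} [MetricSpace M] {q : ℕ → M} (hq : DenseRange q)
    (hM : ∀ α : Ordinal.{0}, α < ω₁ → CoarselyEmbeds (schreierSpace φ α) M) :
    ∃ (m : ℕ) (W T : ℕ → ℕ), Monotone W ∧ ∀ n : ℕ, ∃ F : (ℕ →₀ ℤ) → ℕ, F 0 = m ∧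
      ∀ x y, supNatAbs x ≤ n → supNatAbs y ≤ n →
        dist (q (F x)) (q (F y)) ≤ W (supNatAbs (x - y)) ∧
        ∀ k ≤ supNatAbs (x - y), T k ≤ supNatAbs (x - y) →
          (k : ℝ) ≤ dist (q (F x)) (q (F y)) := by
  have hM' : ∀ α : Ordinal.{0}, ∃ (f : (ℕ+ →₀ ℤ) → ℕ) (w t : ℕ → ℕ), α < ω₁ →
      Monotone w ∧ IsDiscreteEmbedding q (schreier φ α) f w t := by
    intro α
    by_cases hα : α < ω₁
    · obtain ⟨f, w, t, h⟩ := exists_isDiscreteEmbedding hq (hM α hα)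
      exact ⟨f, w, t, fun _ => h⟩
    · exact ⟨fun _ => 0, id, id, fun h => absurd h hα⟩
  choose f w t hf using hM'
  -- Here the rank is a lower bound for the order itself, and nothing needs to be extended.
  obtain ⟨u, hu⟩ := exists_coherent_choice (C := fun _ => ℕ × ℕ × ℕ)
    (fun γ _ α => γ ≤ α ∧ α < ω₁) (fun k α => (w α k, t α k, f α 0))
    (fun γ δ k o hγ ho => ⟨hγ.trans ho.1, ho.2⟩)
    (fun γ hγ => ⟨γ, le_rfl, hγ⟩)
    (fun γ _ k o ho => ⟨o, ⟨(lt_add_one γ).le.trans ho.1, ho.2⟩, fun _ _ => rfl⟩)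
  have hω : (0 : Ordinal.{0}) < ω₁ := Ordinal.omega_pos 1
  refine ⟨(u 0).2.2, fun k => (u k).1, fun k => (u k).2.1, fun a b hab => ?_, fun n => ?_⟩
  · obtain ⟨α, ⟨-, hα⟩, h⟩ := hu b 0 hω
    have := (hf α hα).1 hab
    dsimp only
    rwa [← h a hab, ← h b le_rfl]
  · refine exists_embedding_intBall (W := fun k => (u k).1) (T := fun k => (u k).2.1) hφ
      (fun α hα => (hf α hα).2) fun γ hγ => ?_
    obtain ⟨α, ⟨hγα, hα⟩, h⟩ := hu (2 * n) γ hγ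
    refine ⟨α, hγα, hα, fun j hj => ?_, ?_⟩
    · rw [← h j hj]
      exact ⟨rfl, rfl⟩
    · rw [← h 0 (Nat.zero_le _)]

/-! ### Rounding: from integer balls to balls of `c₀` -/

/-- An element of `c₀` with all entries rounded to integers. -/
noncomputable def roundVector (x : C₀(ℕ+, ℝ)) : ℕ →₀ ℤ :=
  Finsupp.ofSupportFinite (fun j => round (x j.succPNat)) <| by
    have h := x.zero_at_infty'
    rw [Filter.cocompact_eq_cofinite] at h
    have h' := h.eventually (Metric.ball_mem_nhds (0 : ℝ) (show (0 : ℝ) < 1 / 2 by norm_num))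
    rw [Filter.eventually_cofinite] at h'
    refine (h'.preimage Nat.succPNat_injective.injOn).subset fun j hj hlt => hj ?_
    have hlt' : |x j.succPNat| < 1 / 2 := by
      have := mem_ball_zero_iff.1 hlt
      rwa [Real.norm_eq_abs] at this
    rw [abs_lt] at hlt'
    exact round_eq_zero_iff.2 ⟨by linarith [hlt'.1], hlt'.2⟩

theorem roundVector_apply (x : C₀(ℕ+, ℝ)) (j : ℕ) : roundVector x j = round (x j.succPNat) := rfl

theorem roundVector_zero : roundVector 0 = 0 := by
  ext j
  rw [roundVector_apply, ZeroAtInftyContinuousMap.zero_apply, round_zero, Finsupp.zero_apply]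

/-- The radius is an integer, so the rounding error of `1 / 2` cannot push an entry past it. -/
theorem supNatAbs_roundVector_le {x : C₀(ℕ+, ℝ)} {n : ℕ}
    (hx : x ∈ Metric.closedBall (0 : C₀(ℕ+, ℝ)) n) : supNatAbs (roundVector x) ≤ n := by
  rw [supNatAbs_le_iff]
  intro j
  have h₁ := (c₀_abs_sub_le_dist x 0 j.succPNat).trans hx
  rw [ZeroAtInftyContinuousMap.zero_apply, sub_zero] at h₁
  have h₂ := abs_sub_round (x j.succPNat)
  rw [roundVector_apply]
  have h₃ : ((round (x j.succPNat)).natAbs : ℝ) < n + 1 := by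
    rw [Nat.cast_natAbs, Int.cast_abs]
    rw [abs_le] at h₁ h₂
    rw [abs_lt]
    constructor <;> linarith [h₁.1, h₁.2, h₂.1, h₂.2]
  have : (round (x j.succPNat)).natAbs < n + 1 := by exact_mod_cast h₃
  omega

theorem abs_round_sub_round_le (a b : ℝ) : |(round a : ℝ) - round b| ≤ |a - b| + 1 := by
  have ha := abs_sub_round a
  have hb := abs_sub_round b
  have h := abs_sub_abs_le_abs_sub ((round a : ℝ) - round b) (a - b)
  have h' : |(round a : ℝ) - round b - (a - b)| ≤ 1 := by
    rw [abs_le] at *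
    constructor <;> linarith [ha.1, ha.2, hb.1, hb.2]
  linarith

theorem abs_sub_le_round_sub_round (a b : ℝ) : |a - b| ≤ |(round a : ℝ) - round b| + 1 := by
  have ha := abs_sub_round a
  have hb := abs_sub_round b
  have h := abs_sub_abs_le_abs_sub (a - b) ((round a : ℝ) - round b)
  have h' : |a - b - ((round a : ℝ) - round b)| ≤ 1 := by
    rw [abs_le] at *
    constructor <;> linarith [ha.1, ha.2, hb.1, hb.2]
  linarith

theorem supNatAbs_roundVector_sub_le (x y : C₀(ℕ+, ℝ)) :
    supNatAbs (roundVector x - roundVector y) ≤ ⌊nndist x y⌋₊ + 1 := by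
  rw [supNatAbs_le_iff]
  intro j
  rw [← Nat.floor_add_one (zero_le (a := nndist x y)), Nat.le_floor_iff (zero_le (a := _)),
    ← NNReal.coe_le_coe]
  push_cast
  rw [Pi.sub_apply, ← abs_sub_intCast]
  exact (abs_round_sub_round_le _ _).trans
    (add_le_add_left (c₀_abs_sub_le_dist x y j.succPNat) 1)

theorem floor_nndist_sub_one_le (x y : C₀(ℕ+, ℝ)) :
    ⌊nndist x y⌋₊ - 1 ≤ supNatAbs (roundVector x - roundVector y) := by
  have h : dist x y ≤ (supNatAbs (roundVector x - roundVector y) + 1 : ℕ) := by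
    rw [c₀_dist_le_iff (Nat.cast_nonneg _)]
    intro i
    have := abs_sub_le_round_sub_round (x i) (y i)
    have h' := natAbs_le_supNatAbs (roundVector x - roundVector y) i.natPred
    rw [Finsupp.sub_apply, roundVector_apply, roundVector_apply, PNat.succPNat_natPred] at h'
    rw [abs_sub_intCast] at this
    push_cast
    exact this.trans (by gcongr)
  have h' : nndist x y ≤ (supNatAbs (roundVector x - roundVector y) + 1 : ℕ) := by
    rw [← NNReal.coe_le_coe, coe_nndist, NNReal.coe_natCast]
    exact h
  have := Nat.floor_le_of_le h'
  omega

/-- The largest `k ≤ m` with `T k ≤ m`. -/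
def thresholdInverse (T : ℕ → ℕ) (m : ℕ) : ℕ :=
  ((Finset.range (m + 1)).filter fun k => T k ≤ m).sup id

theorem thresholdInverse_mono (T : ℕ → ℕ) : Monotone (thresholdInverse T) := by
  intro a b hab
  refine Finset.sup_mono fun k hk => ?_
  rw [Finset.mem_filter, Finset.mem_range] at hk ⊢
  exact ⟨by omega, hk.2.trans hab⟩

theorem tendsto_thresholdInverse (T : ℕ → ℕ) :
    Filter.Tendsto (thresholdInverse T) Filter.atTop Filter.atTop := by
  refine Filter.tendsto_atTop_atTop.2 fun k => ⟨max k (T k), fun m hm => ?_⟩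
  refine Finset.le_sup (f := id) (Finset.mem_filter.2 ⟨Finset.mem_range.2 ?_, ?_⟩)
  · exact Nat.lt_succ_of_le ((le_max_left _ _).trans hm)
  · exact (le_max_right _ _).trans hm

theorem thresholdInverse_le {T : ℕ → ℕ} {m : ℕ} {a : ℝ} (ha : 0 ≤ a)
    (h : ∀ k ≤ m, T k ≤ m → (k : ℝ) ≤ a) : (thresholdInverse T m : ℝ) ≤ a := by
  rw [← Nat.le_floor_iff ha]
  refine Finset.sup_le fun k hk => ?_
  rw [Finset.mem_filter, Finset.mem_range] at hk
  exact (Nat.le_floor_iff ha).2 (h k (by omega) hk.2)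

theorem exists_ball_embeddings {φ : Ordinal.{0} → ℕ+ → Ordinal.{0}} (hφ : IsLimitSequenceChoice φ)
    {M : Type*} [MetricSpace M] [TopologicalSpace.SeparableSpace M]
    (hM : ∀ α : Ordinal.{0}, α < ω₁ → CoarselyEmbeds (schreierSpace φ α) M) :
    ∃ (m₀ : M) (ρ σ : ℝ≥0 → ℝ≥0), AreCoarseModuli ρ σ ∧
      ∃ F : (n : ℕ) → Metric.closedBall (0 : C₀(ℕ+, ℝ)) n → M,
        ∀ n : ℕ, IsModuliEmbedding ρ σ (F n) ∧
          F n ⟨0, Metric.mem_closedBall_self n.cast_nonneg⟩ = m₀ := by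
  obtain ⟨-, -, -, f, -⟩ := hM 0 (Ordinal.omega_pos 1)
  have : Nonempty M := ⟨f ⟨0, {1}, mem_schreier_zero.2 ⟨1, rfl⟩,
    fun _ _ => ⟨0, Int.cast_zero⟩, fun _ _ => rfl⟩⟩
  let q := TopologicalSpace.denseSeq M
  obtain ⟨m, W, T, hW, hF⟩ :=
    exists_discrete_ball_embeddings hφ (TopologicalSpace.denseRange_denseSeq M) hM
  choose F hF₀ hF using hF
  -- The shifts by `1` absorb the change of distances under rounding.
  refine ⟨q m, fun s => thresholdInverse T (⌊s⌋₊ - 1), fun s => W (⌊s⌋₊ + 1), ⟨?_, ?_, ?_⟩,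
    fun n x => q (F n (roundVector x)), fun n => ⟨fun x y => ?_, ?_⟩⟩
  · intro a b hab
    exact Nat.cast_le.2 (thresholdInverse_mono T (Nat.sub_le_sub_right (Nat.floor_mono hab) 1))
  · intro a b hab
    exact Nat.cast_le.2 (hW (Nat.add_le_add_right (Nat.floor_mono hab) 1))
  · exact tendsto_natCast_atTop_atTop.comp ((tendsto_thresholdInverse T).comp
      ((Filter.tendsto_sub_atTop_nat 1).comp tendsto_nat_floor_atTop))
  · obtain ⟨h₁, h₂⟩ := hF n _ _ (supNatAbs_roundVector_le x.2) (supNatAbs_roundVector_le y.2)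
    have hlow := floor_nndist_sub_one_le (x : C₀(ℕ+, ℝ)) y
    have hup := supNatAbs_roundVector_sub_le (x : C₀(ℕ+, ℝ)) y
    rw [← NNReal.coe_le_coe, ← NNReal.coe_le_coe, coe_nndist, NNReal.coe_natCast,
      NNReal.coe_natCast]
    exact ⟨(Nat.cast_le.2 (thresholdInverse_mono T hlow)).trans
      (thresholdInverse_le dist_nonneg h₂), h₁.trans (Nat.cast_le.2 (hW hup))⟩
  · dsimp only
    rw [roundVector_zero, hF₀]

/-! ### Bounded separable spaces in balls of `c₀` -/

section Universality

variable {X : Type*} [MetricSpace X]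

/-- A bump function around `p i`, of radius `2 * s`, which vanishes within distance `s / 2` of the
points `p m` with `m < i`. -/
noncomputable def denseBump (p : ℕ → X) (s : ℝ) (i : ℕ) (x : X) : ℝ :=
  max 0 ((Finset.range (i + 1)).inf' Finset.nonempty_range_add_one
    fun m => if m = i then 2 * s - dist x (p i) else dist x (p m) - s / 2)

theorem denseBump_nonneg (p : ℕ → X) (s : ℝ) (i : ℕ) (x : X) : 0 ≤ denseBump p s i x :=
  le_max_left _ _

theorem denseBump_le_max (p : ℕ → X) (s : ℝ) (i : ℕ) (x : X) :
    denseBump p s i x ≤ max 0 (2 * s - dist x (p i)) := by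
  refine max_le_max le_rfl ((Finset.inf'_le _ (Finset.self_mem_range_succ i)).trans_eq ?_)
  rw [if_pos rfl]

theorem denseBump_le (p : ℕ → X) {s : ℝ} (hs : 0 ≤ s) (i : ℕ) (x : X) :
    denseBump p s i x ≤ 2 * s :=
  (denseBump_le_max p s i x).trans (max_le (by linarith) (sub_le_self _ dist_nonneg))

theorem denseBump_le_add_dist (p : ℕ → X) (s : ℝ) (i : ℕ) (x y : X) :
    denseBump p s i x ≤ denseBump p s i y + dist x y := by
  refine max_le (add_nonneg (denseBump_nonneg p s i y) dist_nonneg) ?_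
  rw [← sub_le_iff_le_add]
  refine le_max_of_le_right (Finset.le_inf' _ _ fun m hm => ?_)
  rw [sub_le_iff_le_add]
  refine (Finset.inf'_le _ hm).trans ?_
  split_ifs
  · linarith [dist_triangle y x (p i), dist_comm x y]
  · linarith [dist_triangle x y (p m)]

theorem denseBump_eq_zero_of_lt {p : ℕ → X} {s : ℝ} {i m : ℕ} {x : X} (hm : dist x (p m) ≤ s / 2)
    (hi : m < i) : denseBump p s i x = 0 := by
  refine max_eq_left ((Finset.inf'_le _ (Finset.mem_range.2 (hi.trans i.lt_succ_self))).trans ?_)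
  rw [if_neg hi.ne]
  linarith

/-- Take the first `p i` within `s` of `x`: earlier points are at distance at least `s`, so the bump
is large at `x`, while `y` is at least `2 * s` away from `p i`. -/
theorem exists_denseBump_separates {p : ℕ → X} (hp : DenseRange p) {s : ℝ} (hs : 0 < s) (x : X) :
    ∃ i, s / 2 ≤ denseBump p s i x ∧ ∀ y, 3 * s ≤ dist x y → denseBump p s i y = 0 := by
  classical
  have hex := hp.exists_dist_lt x hs
  have hi := Nat.find_spec hex
  refine ⟨Nat.find hex, le_max_of_le_right (Finset.le_inf' _ _ fun m hm => ?_), fun y hy => ?_⟩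
  · split_ifs with h
    · linarith
    · have hm' : m < Nat.find hex := by
        have := Finset.mem_range.1 hm
        omega
      linarith [not_lt.1 (Nat.find_min hex hm')]
  · refine le_antisymm ((denseBump_le_max p s _ y).trans (max_le le_rfl ?_))
      (denseBump_nonneg p s _ y)
    linarith [dist_triangle_right x y (p (Nat.find hex))]

/-- A separable bounded metric space has a `1`-Lipschitz coarse embedding into a ball of `c₀`, with
a lower modulus that does not depend on the space. -/
theorem exists_embedding_c₀_ball [TopologicalSpace.SeparableSpace X] [BoundedSpace X]
    [Nonempty X] : ∃ (n : ℕ) (f : X → Metric.closedBall (0 : C₀(ℕ+, ℝ)) n),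
      IsModuliEmbedding (fun s => (⌊s / 3⌋₊ : ℝ≥0) / 2) id f := by
  classical
  let p := TopologicalSpace.denseSeq X
  have hp : DenseRange p := TopologicalSpace.denseRange_denseSeq X
  obtain ⟨C, hC⟩ := Metric.boundedSpace_iff.1 ‹BoundedSpace X›
  let J := ⌈C⌉₊
  let e : ℕ+ ≃ ℕ × ℕ := Equiv.pnatEquivNat.trans Nat.pairEquiv.symm
  -- One coordinate for each scale and dense point; scales beyond the diameter bound are dropped,
  -- which keeps the image bounded.
  let g : X → ℕ × ℕ → ℝ := fun x a => if a.1 ≤ J then denseBump p a.1 a.2 x else 0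
  have hg₀ : ∀ x a, 0 ≤ g x a := fun x a => by
    simp only [g]
    split_ifs
    exacts [denseBump_nonneg _ _ _ _, le_rfl]
  have hgJ : ∀ x a, g x a ≤ 2 * J := fun x a => by
    simp only [g]
    split_ifs with h
    · have : (a.1 : ℝ) ≤ J := by exact_mod_cast h
      linarith [denseBump_le p (Nat.cast_nonneg a.1) a.2 x]
    · positivity
  have hgL : ∀ x y a, g x a ≤ g y a + dist x y := fun x y a => by
    simp only [g]
    split_ifs
    exacts [denseBump_le_add_dist _ _ _ _ _, by simp]
  have hgf : ∀ x, {a | g x a ≠ 0}.Finite := fun x => by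
    -- At every scale at least `1`, bumps of index beyond `m` vanish at `x`; scale `0` contributes
    -- only zeros.
    obtain ⟨m, hm⟩ := hp.exists_dist_lt x (half_pos one_pos)
    refine (Finset.finite_toSet (Finset.range (J + 1) ×ˢ Finset.range (m + 1))).subset
      fun a ha => ?_
    simp only [Finset.coe_product, Set.mem_prod, Finset.mem_coe, Finset.mem_range]
    by_contra hcon
    refine ha ?_
    simp only [g]
    split_ifs with h
    · rcases Nat.eq_zero_or_pos a.1 with h0 | h0
      · refine le_antisymm ((denseBump_le p (Nat.cast_nonneg _) _ x).trans ?_)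
          (denseBump_nonneg _ _ _ _)
        simp [h0]
      · have : (1 : ℝ) ≤ a.1 := by exact_mod_cast h0
        exact denseBump_eq_zero_of_lt (m := m) (by linarith) (by omega)
    · rfl
  let G : X → C₀(ℕ+, ℝ) := fun x =>
    { toFun := fun i => g x (e i)
      continuous_toFun := continuous_of_discreteTopology
      zero_at_infty' := by
        rw [Filter.cocompact_eq_cofinite]
        refine tendsto_const_nhds.congr' ?_
        rw [Filter.EventuallyEq, Filter.eventually_cofinite]
        exact ((hgf x).preimage e.injective.injOn).subset fun i hi => Ne.symm hi }
  have hGapp : ∀ x i, G x i = g x (e i) := fun _ _ => rfl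
  refine ⟨2 * J, fun x => ⟨G x, ?_⟩, fun x y => ⟨?_, ?_⟩⟩
  · rw [Metric.mem_closedBall, c₀_dist_le_iff (Nat.cast_nonneg _)]
    intro i
    rw [ZeroAtInftyContinuousMap.zero_apply, sub_zero, hGapp, abs_of_nonneg (hg₀ _ _)]
    push_cast
    exact hgJ _ _
  · rw [← NNReal.coe_le_coe, coe_nndist, Subtype.dist_eq]
    push_cast
    have hs : ((⌊nndist x y / 3⌋₊ : ℕ) : ℝ) ≤ dist x y / 3 := by
      have := Nat.floor_le (zero_le (a := nndist x y / 3))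
      rw [← NNReal.coe_le_coe] at this
      simpa using this
    -- The scale is the largest integer `s` with `3 * s ≤ dist x y`, at which some bump separates
    -- the points by `s / 2`.
    obtain ⟨s, hs'⟩ : ∃ s, s = ⌊nndist x y / 3⌋₊ := ⟨_, rfl⟩
    rw [← hs'] at hs ⊢
    rcases Nat.eq_zero_or_pos s with h0 | h0
    · rw [h0, Nat.cast_zero, zero_div]
      exact dist_nonneg
    · obtain ⟨i, hi, hy⟩ := exists_denseBump_separates hp (Nat.cast_pos.2 h0) x
      have hsJ : s ≤ J := by
        have h₁ : (s : ℝ) ≤ J := by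
          linarith [hC x y, Nat.le_ceil C, dist_nonneg (x := x) (y := y)]
        exact_mod_cast h₁
      have h := c₀_abs_sub_le_dist (G x) (G y) (e.symm (s, i))
      rw [hGapp, hGapp, Equiv.apply_symm_apply] at h
      simp only [g, if_pos hsJ] at h
      rw [hy y (by linarith), sub_zero, abs_of_nonneg (denseBump_nonneg _ _ _ _)] at h
      exact hi.trans h
  · rw [← NNReal.coe_le_coe, coe_nndist, Subtype.dist_eq, id, coe_nndist,
      c₀_dist_le_iff dist_nonneg]
    intro i
    rw [hGapp, hGapp, abs_le]
    constructor <;> linarith [hgL x y (e i), hgL y x (e i), dist_comm x y]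

end Universality

theorem IsModuliEmbedding.comp {X Y Z : Type*} [MetricSpace X] [MetricSpace Y] [MetricSpace Z]
    {ρ σ ρ' σ' : ℝ≥0 → ℝ≥0} {f : X → Y} {g : Y → Z} (hρ' : Monotone ρ') (hσ' : Monotone σ')
    (hg : IsModuliEmbedding ρ' σ' g) (hf : IsModuliEmbedding ρ σ f) :
    IsModuliEmbedding (ρ' ∘ ρ) (σ' ∘ σ) (g ∘ f) := fun x y =>
  ⟨(hρ' (hf x y).1).trans (hg _ _).1, (hg _ _).2.trans (hσ' (hf x y).2)⟩

theorem theoremE (φ : Ordinal.{0} → ℕ+ → Ordinal.{0}) (hφ : IsLimitSequenceChoice φ)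
    (M : Type*) [MetricSpace M] [TopologicalSpace.SeparableSpace M]
    (hM : ∀ α : Ordinal.{0}, α < ω₁ → CoarselyEmbeds (schreierSpace φ α) M) :
    (∃ ρ σ : ℝ≥0 → ℝ≥0, AreCoarseModuli ρ σ ∧
      ∀ (X : Type*) [MetricSpace X] [TopologicalSpace.SeparableSpace X] [BoundedSpace X],
        ∃ f : X → M, IsModuliEmbedding ρ σ f) ∧
    (∃ (m₀ : M) (ρ σ : ℝ≥0 → ℝ≥0), AreCoarseModuli ρ σ ∧
      ∃ F : (n : ℕ) → Metric.closedBall (0 : C₀(ℕ+, ℝ)) n → M,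
        ∀ n : ℕ, IsModuliEmbedding ρ σ (F n) ∧
          F n ⟨0, Metric.mem_closedBall_self n.cast_nonneg⟩ = m₀) := by
  have h := exists_ball_embeddings hφ hM
  refine ⟨?_, h⟩
  obtain ⟨m₀, ρ, σ, ⟨hρ, hσ, hlim⟩, F, hF⟩ := h
  refine ⟨ρ ∘ fun s => (⌊s / 3⌋₊ : ℝ≥0) / 2, σ ∘ id, ⟨hρ.comp fun a b hab => ?_, hσ,
    hlim.comp ?_⟩, fun X _ _ _ => ?_⟩
  · gcongr
  · exact (tendsto_natCast_atTop_atTop.comp (tendsto_nat_floor_atTop.comp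
      (Filter.tendsto_id.atTop_div_const (by norm_num)))).atTop_div_const (by norm_num)
  · rcases isEmpty_or_nonempty X with hX | hX
    · exact ⟨fun _ => m₀, fun x => isEmptyElim x⟩
    · obtain ⟨n, f, hf⟩ := exists_embedding_c₀_ball (X := X)
      exact ⟨F n ∘ f, (hF n).1.comp hρ hσ hf⟩
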